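/- Let $d\ge 1$ be an integer, let $\nu\in(d-1,\infty)$, let $C$ and $\Sigma$ be real symmetric positive definite $d\times d$ matrices, and let $\Theta$ be a real $d\times d$ matrix such that $\Theta\Sigma^{-1}$ is symmetric nonnegative definite. Denote by $\mathcal W_d(\nu,\Sigma,\Theta)$ the noncentral Wishart distribution, i.e. the distribution on the positive definite $d\times d$ matrices with density, with respect to $\mathrm dX=\prod_{i\le j}\mathrm dX_{ij}$, \[ f_{\nu,\Sigma,\Theta}(X)=\frac{|X|^{\nu/2-(d+1)/2}\,\mathrm{etr}(-\Sigma^{-1}X/2)}{|2\Sigma|^{\nu/2}\,\Gamma_d(\nu/2)}\,\mathrm{etr}(-\Theta/2)\;{}_0F_1(\nu/2;\Theta\Sigma^{-1}X/4), \] where $|\cdot|$ is the determinant, $\mathrm{etr}(A)=\exp(\mathrm{tr}\,A)$, $\Gamma_d(\beta)=\int_{X>0}\mathrm{etr}(-X)|X|^{\beta-(d+1)/2}\,\mathrm dX$ is the multivariate gamma function, and ${}_0F_1(b;A)=\sum_{k\ge 0}\sum_{\kappa}\frac{C_\kappa(A)}{(b)_\kappa\,k!}$ is the hypergeometric function of matrix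 argument. Here $\kappa=(k_1\ge\dots\ge k_d\ge 0)$ runs over the partitions of $k$ into at most $d$ parts, $C_\kappa(A)$ is the zonal polynomial evaluated at the eigenvalues of $A$, and $(b)_\kappa=\prod_{i=1}^d\prod_{j=0}^{k_i-1}\bigl(b-\tfrac{i-1}{2}+j\bigr)$. If a random matrix $\mathfrak X$ has distribution $\mathcal W_d(\nu,\Sigma,\Theta)$, then the parameters $(\nu,C\Sigma C,C^{-1}\Theta C)$ are again admissible (that is, $C\Sigma C$ is positive definite and $(C^{-1}\Theta C)(C\Sigma C)^{-1}$ is symmetric nonnegative definite), and \[ C\,\mathfrak X\,C\sim\mathcal W_d(\nu,\;C\Sigma C,\;C^{-1}\Theta C). \] -/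

import Mathlib

open MeasureTheory ProbabilityTheory


/-- Partitions of `k` into at most `d` parts, as weakly decreasing `d`-tuples. -/
def zonalParts (d k : ℕ) : Finset (Fin d → ℕ) :=
  {κ ∈ Finset.piAntidiag Finset.univ k | Antitone κ}

/-- The exponent vector `e`, once rearranged in decreasing order, lies below the partition `κ` in
the dominance order: for every `n`, the sum of the `n` largest entries of `e` (that is, the largest
sum over a set of `n` indices) is at most the sum of the first `n` parts of `κ`. -/
def DominatedBy {d : ℕ} (e κ : Fin d → ℕ) : Prop :=
  ∀ S : Finset (Fin d), ∑ i ∈ S, e i ≤ ∑ i with i.val < S.card, κ i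

/-- The differential operator
`∑ᵢ yᵢ² ∂²/∂yᵢ² + ∑ᵢ ∑_{j ≠ i} yᵢ² / (yᵢ - yⱼ) ∂/∂yᵢ` applied to `f`, at a point `y` with distinct
coordinates (the part in the latent roots of the Laplace-Beltrami operator of the cone of positive
definite matrices). -/
noncomputable def laplaceBeltrami {d : ℕ} (f : MvPolynomial (Fin d) ℝ) (y : Fin d → ℝ) : ℝ :=
  ∑ i, y i ^ 2 * MvPolynomial.eval y (MvPolynomial.pderiv i (MvPolynomial.pderiv i f)) +
    ∑ i, ∑ j with j ≠ i, y i ^ 2 / (y i - y j) * MvPolynomial.eval y (MvPolynomial.pderiv i f)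

/-- The eigenvalue `∑ᵢ kᵢ (kᵢ - i) + k (d - 1)` (with `i = 1, …, d`) that belongs to the leading
monomial `y^κ` of a symmetric polynomial. -/
noncomputable def zonalEigenvalue {d : ℕ} (κ : Fin d → ℕ) : ℝ :=
  ∑ i, (κ i : ℝ) * ((κ i : ℝ) - 1 + (d - 1 - (i.val : ℝ)))

/-- The defining properties of the zonal polynomials `C_κ`, where `κ` runs over the partitions of
`k` into at most `d` parts, as polynomials in the `d` latent roots: `C_κ` is a symmetric homogeneous
polynomial of degree `k`, its monomials other than `y^κ` and its permutations are of lower weight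
than `κ`, it is an eigenfunction of the differential operator above (for the eigenvalue of the
leading monomial), and `∑_κ C_κ = (tr Y)^k`. They determine the family and can be satisfied, see
`IsZonalFamily.unique` and `exists_isZonalFamily`. -/
structure IsZonalFamily (d k : ℕ) (Z : (Fin d → ℕ) → MvPolynomial (Fin d) ℝ) : Prop where
  symmetric : ∀ κ ∈ zonalParts d k, (Z κ).IsSymmetric
  homogeneous : ∀ κ ∈ zonalParts d k, (Z κ).IsHomogeneous k
  dominated : ∀ κ ∈ zonalParts d k, ∀ e ∈ (Z κ).support, DominatedBy e κ
  eigen : ∀ κ ∈ zonalParts d k, ∀ y : Fin d → ℝ, Function.Injective y →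
    laplaceBeltrami (Z κ) y = zonalEigenvalue κ * MvPolynomial.eval y (Z κ)
  sum_eq : ∑ κ ∈ zonalParts d k, Z κ = (∑ i, MvPolynomial.X i) ^ k

/-! Existence and uniqueness of the zonal polynomials. -/

namespace Zonal

open MvPolynomial

variable {d : ℕ}

abbrev Pol (d : ℕ) := MvPolynomial (Fin d) ℝ

lemma abel : ∀ {n : ℕ} (δ w : Fin (n+1) → ℝ), Antitone w →
    (∀ m : Fin (n+1), 0 ≤ ∑ i with i ≤ m, δ i) →
    (∑ i, δ i) * w (Fin.last n) ≤ ∑ i, δ i * w i := by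
  intro n
  induction n with
  | zero => intro δ w _ _; simp
  | succ n ih =>
    intro δ w hw hδ
    have h1 := ih (fun i => δ i.castSucc) (fun i => w i.castSucc)
      (fun a b h => hw (by simpa using h)) (fun m => by
        have := hδ m.castSucc
        rw [Finset.sum_filter, Fin.sum_univ_castSucc] at this
        rw [Finset.sum_filter]
        simpa [Fin.castSucc_lt_last, not_le.2] using this)
    have h2 : 0 ≤ ∑ i : Fin (n+1), δ i.castSucc := by
      have := hδ (Fin.last n).castSucc
      rw [Finset.sum_filter, Fin.sum_univ_castSucc] at this
      simpa [Fin.castSucc_lt_last, not_le.2, Fin.le_last] using this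
    have h3 : w (Fin.last (n+1)) ≤ w (Fin.last n).castSucc := hw (Fin.le_last _)
    rw [Fin.sum_univ_castSucc, Fin.sum_univ_castSucc (f := fun i => δ i * w i)]
    nlinarith [mul_le_mul_of_nonneg_left h3 h2]

lemma abel' (δ w : Fin d → ℝ) (hw : Antitone w)
    (hδ : ∀ m : Fin d, 0 ≤ ∑ i with i ≤ m, δ i) (h0 : ∑ i, δ i = 0) :
    0 ≤ ∑ i, δ i * w i := by
  cases d with
  | zero => simp
  | succ n => have := abel δ w hw hδ; rw [h0] at this; simpa using this

/-- Sum of squares of the exponents. -/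
def pot (e : Fin d → ℕ) : ℕ := ∑ i, e i ^ 2

lemma mem_parts {k : ℕ} {κ : Fin d → ℕ} : κ ∈ zonalParts d k ↔ ∑ i, κ i = k ∧ Antitone κ := by
  simp [zonalParts]

lemma dom_partial {e κ : Fin d → ℕ} (h : DominatedBy e κ) (m : Fin d) :
    ∑ i with i ≤ m, e i ≤ ∑ i with i ≤ m, κ i := by
  have := h (Finset.univ.filter (· ≤ m))
  have hc : (Finset.univ.filter (· ≤ m)).card = m.val + 1 := by
    rw [show Finset.univ.filter (· ≤ m) = Finset.Iic m by ext; simp, Fin.card_Iic]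
  rw [hc] at this
  simpa [Nat.lt_succ_iff] using this

lemma dom_strict {e κ : Fin d → ℕ} (he : Antitone e) 
    (h : DominatedBy e κ) (hs : ∑ i, e i = ∑ i, κ i) (hne : e ≠ κ) :
    pot e < pot κ ∧ zonalEigenvalue e < zonalEigenvalue κ := by
  set δ : Fin d → ℝ := fun i => (κ i : ℝ) - e i with hδ
  have hp : ∀ m : Fin d, 0 ≤ ∑ i with i ≤ m, δ i := by
    intro m
    simp only [hδ, Finset.sum_sub_distrib, sub_nonneg]
    exact_mod_cast dom_partial h m
  have h0 : ∑ i, δ i = 0 := by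
    simp only [hδ, Finset.sum_sub_distrib, sub_eq_zero]
    exact_mod_cast hs.symm
  have a1 := abel' δ (fun i => (e i : ℝ)) (fun a b hab => Nat.cast_le.2 (he hab)) hp h0
  have a2 := abel' δ (fun i => -(i.val : ℝ)) (fun a b hab => by
    simp only [neg_le_neg_iff]; exact_mod_cast hab) hp h0
  have a3 : 0 < ∑ i, δ i ^ 2 := by
    obtain ⟨i, hi⟩ := Function.ne_iff.1 hne
    refine Finset.sum_pos' (fun i _ => sq_nonneg _) ⟨i, Finset.mem_univ _, ?_⟩
    have : δ i ≠ 0 := by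
      simp only [hδ, sub_ne_zero]; exact_mod_cast hi.symm
    positivity
  have e1 : (pot κ : ℝ) - pot e = ∑ i, δ i ^ 2 + 2 * ∑ i, δ i * e i := by
    simp only [pot, Nat.cast_sum, Nat.cast_pow, Finset.mul_sum, ← Finset.sum_add_distrib,
      ← Finset.sum_sub_distrib]
    exact Finset.sum_congr rfl fun i _ => by simp only [hδ]; ring
  have e2 : zonalEigenvalue κ - zonalEigenvalue e =
      ((pot κ : ℝ) - pot e) + ((d : ℝ) - 2) * (∑ i, δ i) + ∑ i, δ i * (-(i.val : ℝ)) := by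
    simp only [zonalEigenvalue, pot, Nat.cast_sum, Nat.cast_pow, Finset.mul_sum,
      ← Finset.sum_add_distrib, ← Finset.sum_sub_distrib]
    exact Finset.sum_congr rfl fun i _ => by simp only [hδ]; ring
  constructor
  · have : (pot e : ℝ) < pot κ := by linarith
    exact_mod_cast this
  · rw [h0] at e2; linarith

/-- monomial with exponents at `i`, `j` replaced -/
noncomputable def upd (e : Fin d →₀ ℕ) (i j : Fin d) (a b : ℕ) : Fin d →₀ ℕ :=
  (e.update i a).update j b

lemma upd_apply (e : Fin d →₀ ℕ) (i j : Fin d) (a b : ℕ) (l : Fin d) :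
    upd e i j a b l = if l = j then b else if l = i then a else e l := by
  classical
  simp only [upd, Finsupp.coe_update, Function.update_apply]

/-- Divided difference of a monomial. -/
noncomputable def ddMon (i j : Fin d) (e : Fin d →₀ ℕ) : Pol d :=
  if e j ≤ e i then
    ∑ t ∈ Finset.range (e i - e j), monomial (upd e i j (e i - 1 - t) (e j + t)) 1
  else -∑ t ∈ Finset.range (e j - e i), monomial (upd e i j (e j - 1 - t) (e i + t)) 1

lemma dd_tele (i j : Fin d) (hij : i ≠ j) (e : Fin d →₀ ℕ) (a b : ℕ) (hab : b ≤ a) :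
    (X i - X j : Pol d) * ∑ t ∈ Finset.range (a - b), monomial (upd e i j (a - 1 - t) (b + t)) 1
      = monomial (upd e i j a b) 1 - monomial (upd e i j b a) 1 := by
  classical
  have key : ∀ t ∈ Finset.range (a - b),
      (X i - X j : Pol d) * monomial (upd e i j (a - 1 - t) (b + t)) 1
      = monomial (upd e i j (a - t) (b + t)) 1 -
        monomial (upd e i j (a - (t+1)) (b + (t+1))) 1 := by
    intro t ht
    have ht := Finset.mem_range.1 ht
    rw [sub_mul, X, X, monomial_mul, monomial_mul, one_mul]
    congr 2 <;> congr 1 <;> ext l <;> simp only [Finsupp.add_apply, upd_apply, Finsupp.single_apply]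
    · by_cases h1 : l = j
      · subst h1; simp [hij]
      · by_cases h2 : l = i
        · subst h2; simp [h1]; omega
        · simp [h1, h2, Ne.symm h2]
    · by_cases h1 : l = j
      · subst h1; simp; omega
      · by_cases h2 : l = i
        · subst h2; simp [h1, Ne.symm h1]; omega
        · simp [h1, h2, Ne.symm h1]
  rw [Finset.mul_sum, Finset.sum_congr rfl key,
    Finset.sum_range_sub' (fun t => (monomial (upd e i j (a - t) (b + t)) (1:ℝ)))]
  simp only [Nat.sub_zero, Nat.add_zero]
  rw [show a - (a - b) = b by omega, show b + (a - b) = a by omega]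

lemma mapDomain_swap (i j : Fin d) (e : Fin d →₀ ℕ) :
    Finsupp.mapDomain (Equiv.swap i j) e = upd e i j (e j) (e i) := by
  classical
  ext l
  have : Finsupp.mapDomain (Equiv.swap i j) e l = e (Equiv.swap i j l) := by
    rw [Finsupp.mapDomain_equiv_apply]; simp
  rw [this, upd_apply]
  by_cases h1 : l = j
  · subst h1; simp
  · by_cases h2 : l = i
    · subst h2; simp [h1]
    · simp [h1, h2, Equiv.swap_apply_of_ne_of_ne]

lemma upd_self (i j : Fin d) (e : Fin d →₀ ℕ) : upd e i j (e i) (e j) = e := by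
  ext l; rw [upd_apply]; split_ifs <;> simp_all

lemma ddMon_spec (i j : Fin d) (hij : i ≠ j) (e : Fin d →₀ ℕ) :
    (X i - X j : Pol d) * ddMon i j e
      = monomial e 1 - rename (Equiv.swap i j) (monomial e 1) := by
  rw [rename_monomial, mapDomain_swap, ddMon]
  split_ifs with h
  · rw [dd_tele i j hij e _ _ h, upd_self]
  · rw [mul_neg, dd_tele i j hij e _ _ (by omega), upd_self, neg_sub]

/-- Divided difference `(g - swap g) / (X i - X j)`. -/
noncomputable def dd (i j : Fin d) : Pol d →ₗ[ℝ] Pol d :=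
  (basisMonomials (Fin d) ℝ).constr ℝ (ddMon i j)

lemma dd_monomial (i j : Fin d) (e : Fin d →₀ ℕ) (c : ℝ) :
    dd i j (monomial e c) = c • ddMon i j e := by
  have h : (monomial e c : Pol d) = c • basisMonomials (Fin d) ℝ e := by
    simp [coe_basisMonomials, smul_monomial]
  rw [h, map_smul, dd, Module.Basis.constr_basis]

lemma dd_spec (i j : Fin d) (hij : i ≠ j) (g : Pol d) :
    (X i - X j : Pol d) * dd i j g = g - rename (Equiv.swap i j) g := by
  induction g using MvPolynomial.induction_on' with
  | monomial e c =>
    rw [dd_monomial, mul_smul_comm, ddMon_spec i j hij]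
    simp [smul_sub, smul_monomial, rename_monomial]
  | add p q hp hq => rw [map_add, mul_add, hp, hq, map_add]; ring

lemma X_sub_X_ne (i j : Fin d) (hij : i ≠ j) : (X i - X j : Pol d) ≠ 0 :=
  sub_ne_zero.2 fun h => hij (X_injective h)

lemma dd_unique {i j : Fin d} (hij : i ≠ j) {g q : Pol d}
    (h : (X i - X j : Pol d) * q = g - rename (Equiv.swap i j) g) : dd i j g = q :=
  mul_left_cancel₀ (X_sub_X_ne i j hij) ((dd_spec i j hij g).trans h.symm)

/-- `X i ^ 2 * ∂ i` -/
noncomputable def gop (i : Fin d) (f : Pol d) : Pol d := X i ^ 2 * pderiv i f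

lemma gop_rename (τ : Equiv.Perm (Fin d)) (i : Fin d) (f : Pol d) :
    rename τ (gop i f) = gop (τ i) (rename τ f) := by
  simp [gop, pderiv_rename τ.injective]

lemma dd_rename (τ : Equiv.Perm (Fin d)) {i j : Fin d} (hij : i ≠ j) (g : Pol d) :
    rename τ (dd i j g) = dd (τ i) (τ j) (rename τ g) := by
  refine (dd_unique (τ.injective.ne hij) ?_).symm
  have := congrArg (rename τ) (dd_spec i j hij g)
  rw [map_mul, map_sub, map_sub, rename_X, rename_X] at this
  rw [this, rename_rename, rename_rename]
  congr 3
  ext l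
  simp only [Function.comp]
  rw [Equiv.swap_apply_apply]; simp

lemma dd_symm {i j : Fin d} (hij : i ≠ j) {f : Pol d} (hf : f.IsSymmetric) :
    dd i j (gop i f) = dd j i (gop j f) := by
  refine dd_unique hij ?_
  have h := dd_spec j i hij.symm (gop j f)
  rw [gop_rename, hf] at h ⊢
  simp only [Equiv.swap_apply_left] at h ⊢
  linear_combination -h

/-- `laplaceBeltrami` as an operator on polynomials, correct on the symmetric ones. -/
noncomputable def LB : Pol d →ₗ[ℝ] Pol d where
  toFun f := ∑ i, X i ^ 2 * pderiv i (pderiv i f) +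
    (1/2 : ℝ) • ∑ i, ∑ j with j ≠ i, dd i j (gop i f)
  map_add' f g := by
    simp only [gop, map_add, mul_add, Finset.sum_add_distrib, smul_add]; abel
  map_smul' c f := by
    simp only [gop, (pderiv _).map_smul, map_smul, mul_smul_comm, ← Finset.smul_sum, smul_add,
      RingHom.id_apply]
    rw [smul_comm c]

lemma LB_apply (f : Pol d) : LB f = ∑ i, X i ^ 2 * pderiv i (pderiv i f) +
    (1/2 : ℝ) • ∑ i, ∑ j with j ≠ i, dd i j (gop i f) := rfl

lemma LB_symm {f : Pol d} (hf : f.IsSymmetric) : (LB f).IsSymmetric := by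
  intro τ
  rw [LB_apply, map_add, map_smul, map_sum, map_sum]
  congr 1
  · rw [← Equiv.sum_comp τ (fun i => X i ^ 2 * pderiv i (pderiv i f))]
    refine Finset.sum_congr rfl fun i _ => ?_
    rw [map_mul, map_pow, rename_X, ← pderiv_rename τ.injective, ← pderiv_rename τ.injective, hf]
  · congr 1
    rw [← Equiv.sum_comp τ (fun i => ∑ j with j ≠ i, dd i j (gop i f))]
    refine Finset.sum_congr rfl fun i _ => ?_
    rw [map_sum, Finset.sum_filter, Finset.sum_filter,
      ← Equiv.sum_comp τ (fun j => if j ≠ τ i then dd (τ i) j (gop (τ i) f) else 0)]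
    refine Finset.sum_congr rfl fun j _ => ?_
    simp only [ne_eq, EmbeddingLike.apply_eq_iff_eq]
    by_cases h : j = i
    · simp [h]
    · rw [if_pos h, if_pos h, dd_rename τ (Ne.symm h), gop_rename, hf]

lemma LB_eval {f : Pol d} (hf : f.IsSymmetric) {y : Fin d → ℝ} (hy : Function.Injective y) :
    eval y (LB f) = laplaceBeltrami f y := by
  rw [LB_apply, laplaceBeltrami, map_add, map_sum]
  congr 1
  · simp
  · rw [smul_eval, map_sum]
    simp only [map_sum]
    set a : Fin d → Fin d → ℝ := fun i j => y i ^ 2 / (y i - y j) * eval y (pderiv i f) with ha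
    have h1 : ∀ i, ∀ j ∈ Finset.univ.filter (· ≠ i), eval y (dd i j (gop i f)) = a i j + a j i := by
      intro i j hj
      have hne : j ≠ i := (Finset.mem_filter.1 hj).2
      have h := congrArg (eval y) (dd_spec i j hne.symm (gop i f))
      rw [gop_rename, hf, Equiv.swap_apply_left] at h
      simp only [gop, map_mul, map_sub, eval_X, map_pow] at h
      have h3 : y i - y j ≠ 0 := sub_ne_zero.2 fun h => hne (hy h).symm
      have h4 : y j - y i ≠ 0 := sub_ne_zero.2 fun h => hne (hy h)
      simp only [ha, gop]
      rw [show y j - y i = -(y i - y j) by ring]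
      field_simp
      linear_combination h
    have h2 : ∀ b : Fin d → Fin d → ℝ, (∀ i, b i i = 0) →
        ∀ i, ∑ j with j ≠ i, b i j = ∑ j, b i j := by
      intro b hb i
      rw [Finset.sum_filter]
      exact Finset.sum_congr rfl fun j _ => by by_cases h : j = i <;> simp [h, hb]
    have haa : ∀ i, a i i = 0 := fun i => by simp [ha]
    rw [Finset.sum_congr rfl fun i _ => Finset.sum_congr rfl (h1 i)]
    rw [Finset.sum_congr rfl fun i _ => h2 (fun i j => a i j + a j i) (by simp [haa]) i]
    rw [Finset.sum_congr rfl fun i _ => h2 a haa i]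
    simp only [Finset.sum_add_distrib]
    rw [Finset.sum_comm (f := fun i j => a j i)]
    ring

/-- `a` arises from `e` by moving two entries towards each other. -/
def Inside (a e : Fin d →₀ ℕ) : Prop :=
  a = e ∨ ∃ i j, i ≠ j ∧ (∀ l, l ≠ i → l ≠ j → a l = e l) ∧ a i + a j = e i + e j ∧
    min (e i) (e j) ≤ a i ∧ a i ≤ max (e i) (e j)

lemma gop_monomial (i : Fin d) (e : Fin d →₀ ℕ) (c : ℝ) :
    gop i (monomial e c) = monomial (e + Finsupp.single i 1) (c * e i) := by
  rw [gop, pderiv_monomial, X_pow_eq_monomial, monomial_mul, one_mul]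
  by_cases h : e i = 0
  · simp [h]
  · have : Finsupp.single i 2 + (e - Finsupp.single i 1) = e + Finsupp.single i 1 := by
      ext l
      by_cases hl : l = i
      · subst hl; simp; omega
      · simp [Ne.symm hl]
    rw [this]

lemma ddMon_support {i j : Fin d} {a e : Fin d →₀ ℕ} (hij : i ≠ j)
    (h : coeff a (ddMon i j e) ≠ 0) :
    (∀ l, l ≠ i → l ≠ j → a l = e l) ∧ a i + a j + 1 = e i + e j ∧
      min (e i) (e j) ≤ a i ∧ a i < max (e i) (e j) := by
  classical
  rw [ddMon] at h
  split_ifs at h with hle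
  · rw [coeff_sum] at h
    obtain ⟨t, ht, h⟩ := Finset.exists_ne_zero_of_sum_ne_zero h
    have ht := Finset.mem_range.1 ht
    rw [coeff_monomial] at h
    have h : upd e i j (e i - 1 - t) (e j + t) = a := by
      by_contra hc; simp [hc] at h
    subst h
    refine ⟨fun l h1 h2 => by simp [upd_apply, h1, h2], ?_⟩
    simp only [upd_apply, hij, if_true, if_false]
    omega
  · rw [coeff_neg, neg_ne_zero, coeff_sum] at h
    obtain ⟨t, ht, h⟩ := Finset.exists_ne_zero_of_sum_ne_zero h
    have ht := Finset.mem_range.1 ht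
    rw [coeff_monomial] at h
    have h : upd e i j (e j - 1 - t) (e i + t) = a := by
      by_contra hc; simp [hc] at h
    subst h
    refine ⟨fun l h1 h2 => by simp [upd_apply, h1, h2], ?_⟩
    simp only [upd_apply, hij, if_true, if_false]
    omega

lemma dd_gop_coeff (i j : Fin d) (f : Pol d) (a : Fin d →₀ ℕ) :
    coeff a (dd i j (gop i f)) =
      ∑ e ∈ f.support, coeff e f * (e i * coeff a (ddMon i j (e + Finsupp.single i 1))) := by
  conv_lhs => rw [f.as_sum]
  have : gop i (∑ v ∈ f.support, monomial v (coeff v f)) =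
      ∑ v ∈ f.support, gop i (monomial v (coeff v f)) := by
    simp only [gop, map_sum, Finset.mul_sum]
  rw [this, map_sum, coeff_sum]
  refine Finset.sum_congr rfl fun e _ => ?_
  rw [gop_monomial, dd_monomial, coeff_smul, smul_eq_mul]; ring

lemma coeff_second (i : Fin d) (f : Pol d) (a : Fin d →₀ ℕ) :
    coeff a (X i ^ 2 * pderiv i (pderiv i f)) = a i * ((a i : ℝ) - 1) * coeff a f := by
  induction f using MvPolynomial.induction_on' with
  | monomial e c =>
    rw [pderiv_monomial, pderiv_monomial, X_pow_eq_monomial, monomial_mul, one_mul,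
      coeff_monomial, coeff_monomial]
    by_cases h : e i < 2
    · by_cases h2 : e = a
      · subst h2
        interval_cases h3 : e i <;> simp [h3]
      · interval_cases h3 : e i <;> simp [h3, h2]
    · have : Finsupp.single i 2 + (e - Finsupp.single i 1 - Finsupp.single i 1) = e := by
        ext l
        by_cases hl : l = i
        · subst hl; simp; omega
        · simp [Ne.symm hl]
      rw [this]
      split_ifs with h2
      · subst h2
        simp [Nat.cast_sub (show 1 ≤ e i by omega)]; ring
      · simp
  | add p q hp hq => simp only [map_add, mul_add, coeff_add, hp, hq]

lemma LB_support {f : Pol d} {a : Fin d →₀ ℕ} (h : coeff a (LB f) ≠ 0) :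
    ∃ e ∈ f.support, Inside a e := by
  by_contra hc
  push Not at hc
  apply h
  rw [LB_apply, coeff_add, coeff_smul, coeff_sum, coeff_sum]
  have h0 : coeff a f = 0 := by
    by_contra h0; exact hc a (mem_support_iff.2 h0) (Or.inl rfl)
  rw [Finset.sum_eq_zero fun i _ => by rw [coeff_second, h0, mul_zero]]
  rw [Finset.sum_eq_zero, smul_zero, add_zero]
  intro i _
  rw [coeff_sum]
  refine Finset.sum_eq_zero fun j hj => ?_
  have hne : j ≠ i := (Finset.mem_filter.1 hj).2
  rw [dd_gop_coeff]
  refine Finset.sum_eq_zero fun e he => ?_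
  by_contra h1
  refine hc e he (Or.inr ⟨i, j, hne.symm, ?_⟩)
  have h2 : coeff a (ddMon i j (e + Finsupp.single i 1)) ≠ 0 := fun h => h1 (by simp [h])
  obtain ⟨h3, h4, h5, h6⟩ := ddMon_support hne.symm h2
  refine ⟨fun l hl hl' => by simpa [Ne.symm hl] using h3 l hl hl', ?_⟩
  simp [Ne.symm hne] at h4 h5 h6
  omega

lemma pot_split (e : Fin d → ℕ) {i j : Fin d} (hij : i ≠ j) :
    pot e = e i ^ 2 + e j ^ 2 + ∑ l ∈ (Finset.univ.erase i).erase j, e l ^ 2 := by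
  rw [pot, ← Finset.add_sum_erase _ _ (Finset.mem_univ i),
    ← Finset.add_sum_erase _ _ (show j ∈ Finset.univ.erase i by simp [hij.symm])]
  ring

lemma coeff_pair {f : Pol d} {a : Fin d →₀ ℕ} (ha : Antitone a)
    (hf : ∀ e ∈ f.support, pot e ≤ pot a) {i j : Fin d} (hij : i < j) :
    coeff a (dd i j (gop i f)) = a i * coeff a f := by
  classical
  have hle : a j ≤ a i := ha hij.le
  rw [dd_gop_coeff]
  have hself : coeff a (ddMon i j (a + Finsupp.single i 1)) = 1 := by
    have hb : (a + Finsupp.single i 1 : Fin d →₀ ℕ) j = a j := by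
      simp [hij.ne]
    have hb' : (a + Finsupp.single i 1 : Fin d →₀ ℕ) i = a i + 1 := by simp
    rw [ddMon, hb, hb', if_pos (by omega), coeff_sum, Finset.sum_eq_single 0]
    · rw [coeff_monomial, if_pos]
      ext l; rw [upd_apply]
      split_ifs with h1 h2
      · subst h1; simp
      · subst h2; simp
      · simp [Ne.symm h2]
    · intro t ht ht0
      have ht := Finset.mem_range.1 ht
      rw [coeff_monomial, if_neg]
      intro h
      have := DFunLike.congr_fun h i
      rw [upd_apply] at this
      simp [hij.ne] at this
      omega
    · intro h; simp at h; omega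
  have hother : ∀ e ∈ f.support, e ≠ a →
      coeff e f * (e i * coeff a (ddMon i j (e + Finsupp.single i 1))) = 0 := by
    intro e he hne
    by_contra h1
    have h2 : coeff a (ddMon i j (e + Finsupp.single i 1)) ≠ 0 := fun h => h1 (by simp [h])
    obtain ⟨h3, h4, h5, h6⟩ := ddMon_support hij.ne h2
    have h3' : ∀ l, l ≠ i → l ≠ j → a l = e l := fun l hl hl' => by
      simpa [Ne.symm hl] using h3 l hl hl'
    simp [hij.ne] at h4 h5 h6
    have hp := hf e he
    have h10 : ∑ l ∈ (Finset.univ.erase i).erase j, e l ^ 2 =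
        ∑ l ∈ (Finset.univ.erase i).erase j, a l ^ 2 := Finset.sum_congr rfl fun l hl => by
      rw [h3' l (by simp at hl; tauto) (by simp at hl; tauto)]
    rw [pot_split _ hij.ne, pot_split _ hij.ne, h10] at hp
    have hp' : e i ^ 2 + e j ^ 2 ≤ a i ^ 2 + a j ^ 2 := by omega
    have : e i = a i := by
      rcases le_or_gt (e j) (e i + 1) with hc | hc
      · have h7 : a i ≤ e i := by omega
        by_contra hh
        have h8 : a i < e i := by omega
        have h9 : e j + (e i - a i) = a j := by omega
        obtain ⟨s, hs⟩ := Nat.exists_eq_add_of_lt h8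
        have : a j = e j + (s + 1) := by omega
        nlinarith
      · exfalso
        have h7 : e i + 1 ≤ a i := by omega
        obtain ⟨s, hs⟩ := Nat.exists_eq_add_of_le h7
        have h8 : e j = a j + (s + 1) := by omega
        have h9 : e i < a j := by omega
        nlinarith
    apply hne
    ext l
    by_cases hl : l = i
    · rw [hl, this]
    · by_cases hl' : l = j
      · rw [hl']; omega
      · exact (h3' l hl hl').symm
  by_cases hs : a ∈ f.support
  · rw [Finset.sum_eq_single a hother (fun h => absurd hs h), hself]; ring
  · rw [notMem_support_iff.1 hs, mul_zero]
    exact Finset.sum_eq_zero fun e he => hother e he fun h => hs (h ▸ he)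

lemma LB_coeff {f : Pol d} (hsym : f.IsSymmetric) {a : Fin d →₀ ℕ} (ha : Antitone a)
    (hf : ∀ e ∈ f.support, pot e ≤ pot a) :
    coeff a (LB f) = zonalEigenvalue a * coeff a f := by
  rw [LB_apply, coeff_add, coeff_smul, coeff_sum, coeff_sum]
  simp only [coeff_second, coeff_sum, smul_eq_mul]
  set c := coeff a f
  set b : Fin d → Fin d → ℝ := fun i j => if i < j then a i * c else 0 with hb
  have h1 : ∀ i, ∑ j with j ≠ i, coeff a (dd i j (gop i f)) = ∑ j, (b i j + b j i) := by
    intro i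
    rw [Finset.sum_filter]
    refine Finset.sum_congr rfl fun j _ => ?_
    rcases lt_trichotomy i j with h | h | h
    · simp [hb, h.ne', h, h.not_gt, coeff_pair ha hf h, c]
    · simp [hb, h]
    · rw [if_pos h.ne, dd_symm h.ne' hsym, coeff_pair ha hf h]
      simp [hb, h, h.not_gt, c]
  simp only [h1, Finset.sum_add_distrib]
  rw [Finset.sum_comm (f := fun i j => b j i)]
  have h2 : ∀ i, ∑ j, b i j = (d - 1 - (i.val : ℝ)) * (a i * c) := by
    intro i
    simp only [hb]
    rw [← Finset.sum_filter, Finset.sum_const, nsmul_eq_mul]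
    congr 1
    rw [show Finset.univ.filter (i < ·) = Finset.Ioi i by ext; simp, Fin.card_Ioi]
    have := i.isLt
    rw [Nat.cast_sub (by omega), Nat.cast_sub (by omega)]; simp
  simp only [h2]
  rw [show ∀ x : ℝ, (1/2 : ℝ) * (x + x) = x by intro x; ring, ← Finset.sum_add_distrib,
    zonalEigenvalue, Finset.sum_mul]
  exact Finset.sum_congr rfl fun i _ => by ring

lemma dom_perm {e κ : Fin d → ℕ} (h : DominatedBy e κ) (τ : Equiv.Perm (Fin d)) :
    DominatedBy (e ∘ τ) κ := by
  intro S
  have := h (S.map τ.toEmbedding)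
  simpa using this

lemma dom_inside {a e : Fin d →₀ ℕ} {κ : Fin d → ℕ} (h : DominatedBy e κ) (hi : Inside a e) :
    DominatedBy a κ := by
  classical
  rcases hi with rfl | ⟨i, j, hij, h1, h2, h3, h4⟩
  · exact h
  intro S
  have hsw := dom_perm h (Equiv.swap i j) S
  have hS := h S
  have hR : ∀ R : Finset (Fin d), i ∉ R → j ∉ R → ∑ l ∈ R, a l = ∑ l ∈ R, e l ∧
      ∑ l ∈ R, (e ∘ Equiv.swap i j) l = ∑ l ∈ R, e l := fun R hi hj =>
    ⟨Finset.sum_congr rfl fun l hl => h1 l (fun h => hi (h ▸ hl)) (fun h => hj (h ▸ hl)),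
      Finset.sum_congr rfl fun l hl => congrArg e (Equiv.swap_apply_of_ne_of_ne
        (fun h => hi (h ▸ hl)) (fun h => hj (h ▸ hl)))⟩
  generalize ∑ i with i.val < S.card, κ i = K at *
  by_cases hi : i ∈ S <;> by_cases hj : j ∈ S
  · obtain ⟨r1, -⟩ := hR ((S.erase i).erase j) (by simp) (by simp)
    have hj' : j ∈ S.erase i := by simp [hij.symm, hj]
    have s1 := Finset.add_sum_erase S (fun l => a l) hi
    have s2 := Finset.add_sum_erase (S.erase i) (fun l => a l) hj'
    have s3 := Finset.add_sum_erase S (fun l => e l) hi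
    have s4 := Finset.add_sum_erase (S.erase i) (fun l => e l) hj'
    linarith
  · obtain ⟨r1, r2⟩ := hR (S.erase i) (by simp) (by simp [hj])
    have s1 := Finset.add_sum_erase S (fun l => a l) hi
    have s2 := Finset.add_sum_erase S (fun l => e l) hi
    have s3 := Finset.add_sum_erase S (e ∘ Equiv.swap i j) hi
    simp only [Function.comp, Equiv.swap_apply_left] at s1 s2 s3 r2 hsw
    rcases le_max_iff.1 h4 with h5 | h5 <;> linarith
  · obtain ⟨r1, r2⟩ := hR (S.erase j) (by simp [hi]) (by simp)
    have s1 := Finset.add_sum_erase S (fun l => a l) hj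
    have s2 := Finset.add_sum_erase S (fun l => e l) hj
    have s3 := Finset.add_sum_erase S (e ∘ Equiv.swap i j) hj
    simp only [Function.comp, Equiv.swap_apply_right] at s1 s2 s3 r2 hsw
    rcases min_le_iff.1 h3 with h5 | h5 <;> linarith
  · obtain ⟨r1, -⟩ := hR S hi hj
    linarith

lemma sum_inside {a e : Fin d →₀ ℕ} (hi : Inside a e) : ∑ l, a l = ∑ l, e l := by
  classical
  rcases hi with rfl | ⟨i, j, hij, h1, h2, h3, h4⟩
  · rfl
  have hj' : j ∈ Finset.univ.erase i := by simp [hij.symm]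
  have r1 : ∑ l ∈ (Finset.univ.erase i).erase j, a l = ∑ l ∈ (Finset.univ.erase i).erase j, e l :=
    Finset.sum_congr rfl fun l hl => h1 l (by simp at hl; tauto) (by simp at hl; tauto)
  have s1 := Finset.add_sum_erase Finset.univ (fun l => a l) (Finset.mem_univ i)
  have s2 := Finset.add_sum_erase (Finset.univ.erase i) (fun l => a l) hj'
  have s3 := Finset.add_sum_erase Finset.univ (fun l => e l) (Finset.mem_univ i)
  have s4 := Finset.add_sum_erase (Finset.univ.erase i) (fun l => e l) hj'
  linarith

lemma homog_iff {k : ℕ} {f : Pol d} :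
    f.IsHomogeneous k ↔ ∀ e ∈ f.support, ∑ l, e l = k := by
  constructor
  · intro h e he
    have := h (mem_support_iff.1 he)
    rw [← this, Finsupp.weight_apply, Finsupp.sum_fintype _ _ (by simp)]; simp
  · intro h e he
    rw [← h e (mem_support_iff.2 he), Finsupp.weight_apply, Finsupp.sum_fintype _ _ (by simp)]; simp

lemma coeff_perm {f : Pol d} (hf : f.IsSymmetric) (τ : Equiv.Perm (Fin d)) (e : Fin d →₀ ℕ) :
    coeff (Finsupp.mapDomain τ e) f = coeff e f := by
  have := coeff_rename_mapDomain τ τ.injective f e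
  rwa [hf] at this

lemma exists_sorted {f : Pol d} (hf : f.IsSymmetric) (e : Fin d →₀ ℕ) :
    ∃ a : Fin d →₀ ℕ, Antitone a ∧ coeff a f = coeff e f ∧ pot a = pot e ∧
      (∑ l, a l = ∑ l, e l) ∧ ∀ κ, DominatedBy e κ → DominatedBy a κ := by
  set τ := Tuple.sort (fun i => OrderDual.toDual (e i)) with hτ
  have hm : Antitone (e ∘ τ) := fun a b hab =>
    Tuple.monotone_sort (fun i => OrderDual.toDual (e i)) hab
  have h : ((Finsupp.mapDomain τ.symm e : Fin d →₀ ℕ) : Fin d → ℕ) = e ∘ τ := by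
    ext l; rw [Finsupp.mapDomain_equiv_apply]; simp
  refine ⟨Finsupp.mapDomain τ.symm e, ?_, coeff_perm hf τ.symm e, ?_, ?_, ?_⟩
  · rw [h]; exact hm
  · rw [h]; exact Equiv.sum_comp τ (fun i => e i ^ 2)
  · rw [h]; exact Equiv.sum_comp τ (fun i => e i)
  · intro κ hκ; rw [h]; exact dom_perm hκ τ

/-- Symmetric homogeneous polynomials of degree `k`. -/
def SymHom (d k : ℕ) : Submodule ℝ (Pol d) where
  carrier := {f | f.IsSymmetric ∧ f.IsHomogeneous k}
  add_mem' h h' := ⟨h.1.add h'.1, h.2.add h'.2⟩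
  zero_mem' := ⟨IsSymmetric.zero, isHomogeneous_zero _ _ _⟩
  smul_mem' c _ h := ⟨h.1.smul c, (homogeneousSubmodule (Fin d) ℝ k).smul_mem c h.2⟩

/-- Those whose exponents are dominated by `κ`. -/
def W (d k : ℕ) (κ : Fin d → ℕ) : Submodule ℝ (Pol d) where
  carrier := {f | f ∈ SymHom d k ∧ ∀ e, coeff e f ≠ 0 → DominatedBy e κ}
  add_mem' {f g} h h' := ⟨(SymHom d k).add_mem h.1 h'.1, fun e he => by
    by_cases h0 : coeff e f = 0
    · exact h'.2 e fun h1 => he (by simp [h0, h1])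
    · exact h.2 e h0⟩
  zero_mem' := ⟨(SymHom d k).zero_mem, by simp⟩
  smul_mem' c f h := ⟨(SymHom d k).smul_mem c h.1, fun e he => h.2 e fun h1 => he (by simp [h1])⟩

lemma LB_W {k : ℕ} {κ : Fin d → ℕ} {f : Pol d} (hf : f ∈ W d k κ) : LB f ∈ W d k κ := by
  refine ⟨⟨LB_symm hf.1.1, homog_iff.2 fun a ha => ?_⟩, fun a ha => ?_⟩
  · obtain ⟨e, he, hi⟩ := LB_support (mem_support_iff.1 ha)
    rw [sum_inside hi]; exact homog_iff.1 hf.1.2 e he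
  · obtain ⟨e, he, hi⟩ := LB_support ha
    exact dom_inside (hf.2 e (mem_support_iff.1 he)) hi

/-- A tuple as a finitely supported function. -/
noncomputable def fs (κ : Fin d → ℕ) : Fin d →₀ ℕ := Finsupp.equivFunOnFinite.symm κ

@[simp] lemma fs_coe (κ : Fin d → ℕ) : (fs κ : Fin d → ℕ) = κ := rfl

lemma fs_of (e : Fin d →₀ ℕ) : fs (e : Fin d → ℕ) = e := by ext; rfl

lemma pot_le {k : ℕ} {κ : Fin d → ℕ} (hκ : κ ∈ zonalParts d k) {f : Pol d} (hf : f ∈ W d k κ)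
    (e : Fin d →₀ ℕ) (he : e ∈ f.support) : pot e ≤ pot κ := by
  obtain ⟨a, h1, h2, h3, h4, h5⟩ := exists_sorted hf.1.1 e
  rw [← h3]
  by_cases h : (a : Fin d → ℕ) = κ
  · rw [h]
  · refine (dom_strict h1 (h5 κ (hf.2 e (mem_support_iff.1 he))) ?_ h).1.le
    rw [h4, homog_iff.1 hf.1.2 e he, (mem_parts.1 hκ).1]

lemma LB_coeff_W {k : ℕ} {κ : Fin d → ℕ} (hκ : κ ∈ zonalParts d k) {f : Pol d} (hf : f ∈ W d k κ) :
    coeff (fs κ) (LB f) = zonalEigenvalue κ * coeff (fs κ) f :=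
  LB_coeff (a := fs κ) hf.1.1 (mem_parts.1 hκ).2 (pot_le hκ hf)

/-- An eigenfunction with vanishing leading coefficient vanishes. -/
lemma eigen_zero {k : ℕ} {κ : Fin d → ℕ} (hκ : κ ∈ zonalParts d k) {f : Pol d} (hf : f ∈ W d k κ)
    (h0 : coeff (fs κ) f = 0) (he : LB f = zonalEigenvalue κ • f) : f = 0 := by
  by_contra hne
  obtain ⟨e, hes, hmax⟩ := f.support.exists_max_image (fun e => pot e) (support_nonempty.2 hne)
  obtain ⟨a, h1, h2, h3, h4, h5⟩ := exists_sorted hf.1.1 e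
  have hc : coeff a f ≠ 0 := h2 ▸ mem_support_iff.1 hes
  have hL := LB_coeff hf.1.1 h1 (fun e' he' => h3 ▸ hmax e' he')
  rw [he, coeff_smul, smul_eq_mul] at hL
  have hev := mul_right_cancel₀ hc hL
  by_cases h : (a : Fin d → ℕ) = κ
  · rw [← h, fs_of] at h0; exact hc h0
  · refine (dom_strict h1 (h5 κ (hf.2 e (mem_support_iff.1 hes))) ?_ h).2.ne hev.symm
    rw [h4, homog_iff.1 hf.1.2 e hes, (mem_parts.1 hκ).1]

lemma symHom_ext {k : ℕ} {f : Pol d} (hf : f ∈ SymHom d k)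
    (h : ∀ κ ∈ zonalParts d k, coeff (fs κ) f = 0) : f = 0 := by
  ext e
  rw [coeff_zero]
  by_contra hc
  obtain ⟨a, h1, h2, h3, h4, h5⟩ := exists_sorted hf.1 e
  apply hc
  rw [← h2, ← fs_of a]
  refine h a (mem_parts.2 ⟨?_, h1⟩)
  rw [h4]; exact homog_iff.1 hf.2 e (mem_support_iff.2 hc)

/-- Coefficients at partitions. -/
noncomputable def Q (d k : ℕ) : SymHom d k →ₗ[ℝ] (zonalParts d k → ℝ) where
  toFun f κ := coeff (fs κ.1) f.1
  map_add' f g := by ext; simp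
  map_smul' c f := by ext; simp

lemma Q_inj (d k : ℕ) : Function.Injective (Q d k) := by
  rw [← LinearMap.ker_eq_bot, LinearMap.ker_eq_bot']
  intro f hf
  exact Subtype.ext (symHom_ext f.2 fun κ hκ => congrFun hf ⟨κ, hκ⟩)

instance symHom_finiteDimensional (d k : ℕ) : FiniteDimensional ℝ (SymHom d k) :=
  Module.Finite.of_injective (Q d k) (Q_inj d k)

lemma sum_le_of_antitone {κ : Fin d → ℕ} (hκ : Antitone κ) : DominatedBy κ κ := by
  intro S
  have hcard : S.card ≤ d := by simpa using S.card_le_univ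
  have h1 : ∑ i ∈ S, κ i = ∑ l : Fin S.card, κ (S.orderEmbOfFin rfl l) := by
    refine Eq.trans ?_ (Finset.sum_map Finset.univ (S.orderEmbOfFin rfl).toEmbedding κ)
    congr 1
    ext i
    simp only [Finset.mem_map, Finset.mem_univ, true_and]
    have := Finset.range_orderEmbOfFin S rfl
    constructor
    · intro hi
      have : i ∈ Set.range (S.orderEmbOfFin rfl) := by rw [this]; exact hi
      exact this
    · rintro ⟨l, rfl⟩; exact Finset.orderEmbOfFin_mem S rfl l
  have h2 : ∑ i with i.val < S.card, κ i = ∑ l : Fin S.card, κ (Fin.castLE hcard l) := by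
    refine Eq.trans ?_ (Finset.sum_map Finset.univ (Fin.castLEEmb hcard) κ)
    congr 1
    ext i
    simp only [Finset.mem_map, Finset.mem_univ, true_and, Finset.mem_filter]
    constructor
    · intro hi; exact ⟨⟨i, hi⟩, rfl⟩
    · rintro ⟨l, rfl⟩; simp
  rw [h1, h2]
  refine Finset.sum_le_sum fun l _ => hκ ?_
  have key : ∀ n (hn : n < S.card), n ≤ (S.orderEmbOfFin rfl ⟨n, hn⟩ : Fin d).val := by
    intro n
    induction n with
    | zero => intro _; omega
    | succ n ih =>
      intro hn
      have h3 := ih (by omega)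
      have h4 : S.orderEmbOfFin rfl ⟨n, by omega⟩ < S.orderEmbOfFin rfl ⟨n+1, hn⟩ :=
        (S.orderEmbOfFin rfl).strictMono (by simp)
      have : (S.orderEmbOfFin rfl ⟨n, by omega⟩).val < (S.orderEmbOfFin rfl ⟨n+1, hn⟩).val := h4
      omega
  exact key l.1 l.2

/-- Monomial symmetric polynomial. -/
lemma exists_msym {k : ℕ} {κ : Fin d → ℕ} (hκ : κ ∈ zonalParts d k) :
    ∃ f ∈ W d k κ, coeff (fs κ) f = 1 := by
  classical
  set g : Pol d := ∑ τ : Equiv.Perm (Fin d), rename τ (monomial (fs κ) (1 : ℝ)) with hg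
  have hdom := sum_le_of_antitone (mem_parts.1 hκ).2
  have hsupp : ∀ e, coeff e g ≠ 0 → ∃ τ : Equiv.Perm (Fin d), (e : Fin d → ℕ) = κ ∘ τ := by
    intro e he
    rw [hg, coeff_sum] at he
    obtain ⟨τ, _, h⟩ := Finset.exists_ne_zero_of_sum_ne_zero he
    rw [rename_monomial, coeff_monomial] at h
    have h : Finsupp.mapDomain τ (fs κ) = e := by by_contra hc; simp [hc] at h
    refine ⟨τ.symm, ?_⟩
    rw [← h]
    ext l; rw [Finsupp.mapDomain_equiv_apply]; rfl
  have hpos : 0 < coeff (fs κ) g := by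
    rw [hg, coeff_sum]
    refine Finset.sum_pos' (fun τ _ => ?_) ⟨1, Finset.mem_univ _, ?_⟩
    · rw [rename_monomial, coeff_monomial]; split_ifs <;> norm_num
    · rw [rename_monomial, coeff_monomial, if_pos (by simp)]; norm_num
  have hW : g ∈ W d k κ := by
    refine ⟨⟨fun σ => ?_, homog_iff.2 fun e he => ?_⟩, fun e he => ?_⟩
    · rw [hg, map_sum, ← Equiv.sum_comp (Equiv.mulLeft σ)
        (fun τ : Equiv.Perm (Fin d) => rename τ (monomial (fs κ) (1 : ℝ)))]
      refine Finset.sum_congr rfl fun τ _ => ?_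
      rw [rename_rename]; rfl
    · obtain ⟨τ, h⟩ := hsupp e (mem_support_iff.1 he)
      rw [h, ← (mem_parts.1 hκ).1]; exact Equiv.sum_comp τ κ
    · obtain ⟨τ, h⟩ := hsupp e he
      rw [h]; exact dom_perm hdom τ
  refine ⟨(coeff (fs κ) g)⁻¹ • g, (W d k κ).smul_mem _ hW, ?_⟩
  rw [coeff_smul, smul_eq_mul, inv_mul_cancel₀ hpos.ne']

lemma exists_eigen {k : ℕ} {κ : Fin d → ℕ} (hκ : κ ∈ zonalParts d k) :
    ∃ f ∈ W d k κ, coeff (fs κ) f = 1 ∧ LB f = zonalEigenvalue κ • f := by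
  let U : Submodule ℝ (Pol d) := W d k κ ⊓ LinearMap.ker (lcoeff ℝ (fs κ))
  have hU : ∀ f, f ∈ U ↔ f ∈ W d k κ ∧ coeff (fs κ) f = 0 := fun f => by
    simp [U, Submodule.mem_inf, LinearMap.mem_ker, lcoeff]
  have hUS : U ≤ SymHom d k := fun f hf => ((hU f).1 hf).1.1
  have : FiniteDimensional ℝ U :=
    Module.Finite.of_injective (Submodule.inclusion hUS) (Submodule.inclusion_injective hUS)
  let N : Pol d →ₗ[ℝ] Pol d := LB - zonalEigenvalue κ • LinearMap.id
  have hNa : ∀ f, N f = LB f - zonalEigenvalue κ • f := fun f => rfl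
  have hN : ∀ f ∈ W d k κ, N f ∈ U := by
    intro f hf
    rw [hU, hNa]
    refine ⟨(W d k κ).sub_mem (LB_W hf) ((W d k κ).smul_mem _ hf), ?_⟩
    rw [coeff_sub, coeff_smul, LB_coeff_W hκ hf, smul_eq_mul, sub_self]
  let N' : U →ₗ[ℝ] U := N.restrict fun f hf => hN f ((hU f).1 hf).1
  have hinj : Function.Injective N' := by
    rw [← LinearMap.ker_eq_bot, LinearMap.ker_eq_bot']
    intro f hf
    have h1 : N f.1 = 0 := congrArg Subtype.val hf
    rw [hNa, sub_eq_zero] at h1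
    exact Subtype.ext (eigen_zero hκ ((hU _).1 f.2).1 ((hU _).1 f.2).2 h1)
  have hsurj := LinearMap.injective_iff_surjective.1 hinj
  obtain ⟨m, hm, hm1⟩ := exists_msym hκ
  obtain ⟨u, hu⟩ := hsurj ⟨N m, hN m hm⟩
  have hu : N u.1 = N m := congrArg Subtype.val hu
  refine ⟨m - u.1, (W d k κ).sub_mem hm ((hU _).1 u.2).1, ?_, ?_⟩
  · rw [coeff_sub, ((hU _).1 u.2).2, hm1, sub_zero]
  · rw [← sub_eq_zero, ← hNa, map_sub, hu, sub_self]

/-- Linear independence of triangular families. -/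
lemma comb_zero {k : ℕ} (P : (Fin d → ℕ) → Pol d)
    (hP : ∀ κ ∈ zonalParts d k, P κ ∈ W d k κ) (hP1 : ∀ κ ∈ zonalParts d k, coeff (fs κ) (P κ) = 1)
    (c : (Fin d → ℕ) → ℝ) (h : ∑ κ ∈ zonalParts d k, c κ • P κ = 0) :
    ∀ κ ∈ zonalParts d k, c κ = 0 := by
  by_contra hc
  push Not at hc
  obtain ⟨κ₀, hκ₀, hc₀⟩ := hc
  obtain ⟨κ, hκ, hmax⟩ := ((zonalParts d k).filter (c · ≠ 0)).exists_max_image pot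
    ⟨κ₀, Finset.mem_filter.2 ⟨hκ₀, hc₀⟩⟩
  obtain ⟨hκ, hcκ⟩ := Finset.mem_filter.1 hκ
  apply hcκ
  have h1 := congrArg (coeff (fs κ)) h
  rw [coeff_sum, Finset.sum_eq_single κ, coeff_smul, hP1 κ hκ] at h1
  · simpa using h1
  · intro μ hμ hne
    rw [coeff_smul, smul_eq_mul]
    by_contra h2
    have h3 : c μ ≠ 0 := fun h => h2 (by simp [h])
    have h4 : coeff (fs κ) (P μ) ≠ 0 := fun h => h2 (by simp [h])
    have h5 := (dom_strict (mem_parts.1 hκ).2 ((hP μ hμ).2 _ h4)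
      (by rw [(mem_parts.1 hκ).1, (mem_parts.1 hμ).1]) hne.symm).1
    have := hmax μ (Finset.mem_filter.2 ⟨hμ, h3⟩)
    omega
  · intro h; exact absurd hκ h

lemma laplace_eq_iff {f : Pol d} (hf : f.IsSymmetric) (c : ℝ) :
    LB f = c • f ↔ ∀ y : Fin d → ℝ, Function.Injective y → laplaceBeltrami f y = c * eval y f := by
  constructor
  · intro h y hy; rw [← LB_eval hf hy, h, smul_eval]
  · intro h
    have hV : (∏ i : Fin d, ∏ j ∈ Finset.univ.filter (· ≠ i), (X i - X j : Pol d)) ≠ 0 :=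
      Finset.prod_ne_zero_iff.2 fun i _ => Finset.prod_ne_zero_iff.2 fun j hj =>
        X_sub_X_ne i j (Finset.mem_filter.1 hj).2.symm
    refine mul_left_cancel₀ hV (MvPolynomial.funext fun y => ?_)
    rw [map_mul, map_mul]
    by_cases hy : Function.Injective y
    · rw [LB_eval hf hy, h y hy, smul_eval]
    · have : eval y (∏ i : Fin d, ∏ j ∈ Finset.univ.filter (· ≠ i), (X i - X j : Pol d)) = 0 := by
        simp only [Function.Injective, not_forall] at hy
        obtain ⟨i, j, h1, h2⟩ := hy
        rw [map_prod]
        refine Finset.prod_eq_zero (Finset.mem_univ i) ?_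
        rw [map_prod]
        refine Finset.prod_eq_zero (i := j)
          (Finset.mem_filter.2 ⟨Finset.mem_univ _, fun h => h2 h.symm⟩) ?_
        simp [h1]
      rw [this, zero_mul, zero_mul]

lemma family_mem {k : ℕ} {Z : (Fin d → ℕ) → Pol d} (hZ : IsZonalFamily d k Z)
    {κ : Fin d → ℕ} (hκ : κ ∈ zonalParts d k) : Z κ ∈ W d k κ :=
  ⟨⟨hZ.symmetric κ hκ, hZ.homogeneous κ hκ⟩,
    fun e he => hZ.dominated κ hκ e (mem_support_iff.2 he)⟩

end Zonal

open Zonal in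
theorem exists_isZonalFamily (d k : ℕ) : ∃ Z, IsZonalFamily d k Z := by
  have h := fun κ : zonalParts d k => exists_eigen κ.2
  choose P' hP' using h
  let P : (Fin d → ℕ) → Pol d := fun κ => if h : κ ∈ zonalParts d k then P' ⟨κ, h⟩ else 0
  have hP : ∀ κ ∈ zonalParts d k, P κ ∈ W d k κ ∧ MvPolynomial.coeff (fs κ) (P κ) = 1 ∧
      LB (P κ) = zonalEigenvalue κ • P κ := fun κ hκ => by
    simp only [P, dif_pos hκ]; exact hP' ⟨κ, hκ⟩
  let T : (zonalParts d k → ℝ) →ₗ[ℝ] SymHom d k :=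
    ∑ κ : zonalParts d k, (LinearMap.proj κ).smulRight
      (⟨P κ.1, (hP κ.1 κ.2).1.1⟩ : SymHom d k)
  have hT : ∀ c : (Fin d → ℕ) → ℝ, (T (fun κ => c κ.1)).1 = ∑ κ ∈ zonalParts d k, c κ • P κ := by
    intro c
    rw [← Finset.sum_coe_sort]
    simp [T]
  have hext : ∀ c : zonalParts d k → ℝ, ∃ c' : (Fin d → ℕ) → ℝ, c = fun κ => c' κ.1 := fun c =>
    ⟨fun κ => if h : κ ∈ zonalParts d k then c ⟨κ, h⟩ else 0, by ext κ; simp⟩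
  have hTinj : Function.Injective T := by
    rw [← LinearMap.ker_eq_bot, LinearMap.ker_eq_bot']
    intro c hc
    obtain ⟨c', rfl⟩ := hext c
    have h1 := hT c'
    rw [hc] at h1
    ext κ
    exact comb_zero P (fun κ hκ => (hP κ hκ).1) (fun κ hκ => (hP κ hκ).2.1) c' h1.symm κ.1 κ.2
  have hs : Function.Surjective ((Q d k) ∘ₗ T) :=
    LinearMap.injective_iff_surjective.1 ((Q_inj d k).comp hTinj)
  have htr : (∑ i, MvPolynomial.X i : Pol d) ^ k ∈ SymHom d k := by
    refine ⟨fun τ => ?_, ?_⟩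
    · rw [map_pow, map_sum]
      congr 1
      simp only [MvPolynomial.rename_X]
      exact Equiv.sum_comp τ (fun i => (MvPolynomial.X i : Pol d))
    · have := (MvPolynomial.IsHomogeneous.sum Finset.univ (fun i => (MvPolynomial.X i : Pol d)) 1
        fun i _ => MvPolynomial.isHomogeneous_X ℝ i).pow k
      simpa using this
  obtain ⟨c, hc⟩ := hs (Q d k ⟨_, htr⟩)
  have hc := Q_inj d k hc
  obtain ⟨c, rfl⟩ := hext c
  have hc := congrArg Subtype.val hc
  rw [hT] at hc
  have hW : ∀ κ ∈ zonalParts d k, c κ • P κ ∈ W d k κ := fun κ hκ =>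
    (W d k κ).smul_mem _ (hP κ hκ).1
  exact ⟨fun κ => c κ • P κ,
    { symmetric := fun κ hκ => (hW κ hκ).1.1
      homogeneous := fun κ hκ => (hW κ hκ).1.2
      dominated := fun κ hκ e he => (hW κ hκ).2 e (MvPolynomial.mem_support_iff.1 he)
      eigen := fun κ hκ => (laplace_eq_iff (hW κ hκ).1.1 _).1 (by
        rw [map_smul, (hP κ hκ).2.2, smul_comm])
      sum_eq := hc }⟩

open Zonal in
theorem IsZonalFamily.unique {d k : ℕ} {Z Z' : (Fin d → ℕ) → MvPolynomial (Fin d) ℝ}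
    (h : IsZonalFamily d k Z) (h' : IsZonalFamily d k Z') :
    ∀ κ ∈ zonalParts d k, Z κ = Z' κ := by
  have h0 := fun κ : zonalParts d k => exists_eigen κ.2
  choose P' hP' using h0
  let P : (Fin d → ℕ) → Pol d := fun κ => if h : κ ∈ zonalParts d k then P' ⟨κ, h⟩ else 0
  have hP : ∀ κ ∈ zonalParts d k, P κ ∈ W d k κ ∧ MvPolynomial.coeff (fs κ) (P κ) = 1 ∧
      LB (P κ) = zonalEigenvalue κ • P κ := fun κ hκ => by
    simp only [P, dif_pos hκ]; exact hP' ⟨κ, hκ⟩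
  have hrep : ∀ Z, IsZonalFamily d k Z → ∀ κ ∈ zonalParts d k,
      Z κ = MvPolynomial.coeff (fs κ) (Z κ) • P κ := by
    intro Z hZ κ hκ
    rw [← sub_eq_zero]
    refine eigen_zero hκ ((W d k κ).sub_mem (family_mem hZ hκ)
      ((W d k κ).smul_mem _ (hP κ hκ).1)) ?_ ?_
    · rw [MvPolynomial.coeff_sub, MvPolynomial.coeff_smul, (hP κ hκ).2.1]; simp
    · rw [map_sub, map_smul, (hP κ hκ).2.2,
        (laplace_eq_iff (hZ.symmetric κ hκ) _).2 (hZ.eigen κ hκ), smul_sub, smul_comm]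
  have hz := comb_zero P (fun κ hκ => (hP κ hκ).1) (fun κ hκ => (hP κ hκ).2.1)
    (fun κ => MvPolynomial.coeff (fs κ) (Z κ) - MvPolynomial.coeff (fs κ) (Z' κ)) (by
      simp only [sub_smul, Finset.sum_sub_distrib]
      rw [← Finset.sum_congr rfl (hrep Z h), ← Finset.sum_congr rfl (hrep Z' h'), h.sum_eq,
        h'.sum_eq, sub_self])
  intro κ hκ
  rw [hrep Z h κ hκ, hrep Z' h' κ hκ, sub_eq_zero.1 (hz κ hκ)]

/-- The zonal polynomial `C_κ` in the `d` latent roots, for a partition `κ` of `k` into at most `d`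
parts. -/
noncomputable def zonalPolynomial (d k : ℕ) (κ : Fin d → ℕ) : MvPolynomial (Fin d) ℝ :=
  (exists_isZonalFamily d k).choose κ

theorem isZonalFamily_zonalPolynomial (d k : ℕ) : IsZonalFamily d k (zonalPolynomial d k) :=
  (exists_isZonalFamily d k).choose_spec

/-- The real latent roots (eigenvalues with multiplicity) of a square matrix, in decreasing order,
filled up with zeros if there are fewer than `d` of them. A product of two nonnegative definite
matrices has `d` real latent roots. -/
noncomputable def latentRoots {d : ℕ} (A : Matrix (Fin d) (Fin d) ℝ) : Fin d → ℝ :=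
  fun i => (A.charpoly.roots.sort (· ≥ ·)).getD i 0

/-- The zonal polynomial of a matrix with real latent roots. -/
noncomputable def zonal {d : ℕ} (k : ℕ) (κ : Fin d → ℕ) (A : Matrix (Fin d) (Fin d) ℝ) : ℝ :=
  MvPolynomial.eval (latentRoots A) (zonalPolynomial d k κ)

/-- The generalized rising factorial `(b)_κ = ∏ᵢ (b - (i - 1) / 2)_{kᵢ}`, `i = 1, …, d`. -/
noncomputable def generalizedPochhammer {d : ℕ} (b : ℝ) (κ : Fin d → ℕ) : ℝ :=
  ∏ i, (ascPochhammer ℝ (κ i)).eval (b - (i.val : ℝ) / 2)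

/-- The hypergeometric function `₀F₁(b; A)` of matrix argument. -/
noncomputable def hypergeometric0F1 {d : ℕ} (b : ℝ) (A : Matrix (Fin d) (Fin d) ℝ) : ℝ :=
  ∑' k : ℕ, ∑ κ ∈ zonalParts d k, 1 / generalizedPochhammer b κ * (zonal k κ A / k.factorial)

/-- The entrywise (product, equivalently Borel) σ-algebra on real matrices. -/
instance realMatrixMeasurableSpace {m n : Type*} : MeasurableSpace (Matrix m n ℝ) :=
  inferInstanceAs (MeasurableSpace (m → n → ℝ))

/-- The symmetric matrix with given entries on and above the diagonal. -/
def symmetricOfUpper {d : ℕ} (v : {p : Fin d × Fin d // p.1 ≤ p.2} → ℝ) :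
    Matrix (Fin d) (Fin d) ℝ :=
  Matrix.of fun i j => if h : i ≤ j then v ⟨(i, j), h⟩ else v ⟨(j, i), le_of_not_ge h⟩

theorem measurable_symmetricOfUpper (d : ℕ) :
    Measurable (symmetricOfUpper : ({p : Fin d × Fin d // p.1 ≤ p.2} → ℝ) → _) := by
  refine measurable_pi_iff.2 fun i => measurable_pi_iff.2 fun j => ?_
  by_cases h : i ≤ j
  · simpa [symmetricOfUpper, h] using measurable_pi_apply _
  · simpa [symmetricOfUpper, h] using measurable_pi_apply _

/-- The Lebesgue measure `dX = ∏_{i ≤ j} dX_{ij}` on the symmetric `d × d` matrices, as a measure on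
all `d × d` matrices. -/
noncomputable def symmetricLebesgue (d : ℕ) : Measure (Matrix (Fin d) (Fin d) ℝ) :=
  Measure.map symmetricOfUpper volume

/-- The exponential trace. -/
noncomputable def etr {d : ℕ} (A : Matrix (Fin d) (Fin d) ℝ) : ℝ := Real.exp A.trace

/-- The multivariate gamma function, at real `β > (d - 1) / 2`. -/
noncomputable def multivariateGamma (d : ℕ) (β : ℝ) : ℝ :=
  ∫ X in {X : Matrix (Fin d) (Fin d) ℝ | X.PosDef},
    etr (-X) * X.det ^ (β - ((d : ℝ) + 1) / 2) ∂symmetricLebesgue d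

/-- The density of the noncentral Wishart distribution on the positive definite matrices. -/
noncomputable def wishartDensity {d : ℕ} (ν : ℝ) (S Θ X : Matrix (Fin d) (Fin d) ℝ) : ℝ :=
  X.det ^ (ν / 2 - ((d : ℝ) + 1) / 2) * etr (-(1 / 2 : ℝ) • (S⁻¹ * X)) /
      (((2 : ℝ) • S).det ^ (ν / 2) * multivariateGamma d (ν / 2)) *
    etr (-(1 / 2 : ℝ) • Θ) * hypergeometric0F1 (ν / 2) ((1 / 4 : ℝ) • (Θ * S⁻¹ * X))

/-- The noncentral Wishart distribution `W_d(ν, S, Θ)`, for `ν > d - 1`, `S` positive definite and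
`Θ S⁻¹` nonnegative definite. -/
noncomputable def noncentralWishart {d : ℕ} (ν : ℝ) (S Θ : Matrix (Fin d) (Fin d) ℝ) :
    Measure (Matrix (Fin d) (Fin d) ℝ) :=
  ((symmetricLebesgue d).restrict {X | X.PosDef}).withDensity
    fun X => ENNReal.ofReal (wishartDensity ν S Θ X)

/-! The proof is a change of variables along `X ↦ C X C`. This map preserves the positive definite
cone, and on the symmetric matrices it is a linear bijection with Jacobian determinant `|C|^(d+1)`
(`congrUpper.det_eq`), so it pushes `dX` forward to `|C|^(-(d+1)) dX` (`map_symmetricLebesgue`).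

The density picks up the same constant (`wishartDensity_congr`). The arguments of the two `etr`
factors and of `₀F₁` are merely conjugated by `C`: `(C S C)⁻¹ (C X C) = C⁻¹ (S⁻¹ X) C`, and `C⁻¹ Θ C
(C S C)⁻¹ C X C = C⁻¹ (Θ S⁻¹ X) C`. Traces are invariant under conjugation, and so is `₀F₁`, since
the zonal polynomials see a matrix only through its latent roots. What remains are the determinants:
`|C X C|^(ν/2 - (d+1)/2)` contributes `|C|^(ν - (d+1))`, `|2 C S C|^(ν/2)` contributes `|C|^ν`, and
the quotient is `|C|^(-(d+1))`. The two constants cancel in `map_noncentralWishart`.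

The Jacobian comes from multiplicativity. `A ↦ det (congrUpper A)` is a multiplicative function, and
every square matrix is a product of diagonal matrices and transvections, so only these two kinds
have to be computed. -/

open Matrix in
/-- The action `X ↦ A X Aᵀ` on the symmetric matrices, in the coordinates on and above the
diagonal. -/
def congrUpper {d : ℕ} (A : Matrix (Fin d) (Fin d) ℝ) :
    ({p : Fin d × Fin d // p.1 ≤ p.2} → ℝ) →ₗ[ℝ] ({p : Fin d × Fin d // p.1 ≤ p.2} → ℝ) where
  toFun v p := (A * symmetricOfUpper v * Aᵀ) p.1.1 p.1.2
  map_add' v w := by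
    have : symmetricOfUpper (v + w) = symmetricOfUpper v + symmetricOfUpper w := by
      ext i j; by_cases h : i ≤ j <;> simp [symmetricOfUpper, h]
    ext p
    simp [this, Matrix.mul_add, Matrix.add_mul]
  map_smul' c v := by
    have : symmetricOfUpper (c • v) = c • symmetricOfUpper v := by
      ext i j; by_cases h : i ≤ j <;> simp [symmetricOfUpper, h]
    ext p
    simp [this]

/-! ### Jacobian of the congruence action on symmetric matrices. -/

namespace congrUpper

open Matrix

variable {d : ℕ}

lemma symmetricOfUpper_transpose (v : {p : Fin d × Fin d // p.1 ≤ p.2} → ℝ) :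
    (symmetricOfUpper v)ᵀ = symmetricOfUpper v := by
  ext i j
  rcases lt_trichotomy i j with h | rfl | h
  · simp [symmetricOfUpper, h.le, h.not_ge]
  · simp
  · simp [symmetricOfUpper, h.le, h.not_ge]

lemma symmetricOfUpper_apply (A : Matrix (Fin d) (Fin d) ℝ)
    (v : {p : Fin d × Fin d // p.1 ≤ p.2} → ℝ) :
    symmetricOfUpper (congrUpper A v) = A * symmetricOfUpper v * Aᵀ := by
  -- `congrUpper` records only the entries on and above the diagonal; symmetry of the product
  -- recovers those below.
  have hs : (A * symmetricOfUpper v * Aᵀ)ᵀ = A * symmetricOfUpper v * Aᵀ := by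
    simp [Matrix.transpose_mul, symmetricOfUpper_transpose, Matrix.mul_assoc]
  ext i j
  by_cases h : i ≤ j
  · simp [symmetricOfUpper, h, congrUpper]
  · have := congrFun (congrFun hs i) j
    rw [← this]
    simp [symmetricOfUpper, h, congrUpper]

lemma symmetricOfUpper_injective :
    Function.Injective
      (symmetricOfUpper : ({p : Fin d × Fin d // p.1 ≤ p.2} → ℝ) → Matrix (Fin d) (Fin d) ℝ) := by
  intro v w h
  ext p
  have := congrFun (congrFun h p.1.1) p.1.2
  simpa [symmetricOfUpper, p.2] using this

/-- Multiplicativity is what allows the Jacobian to be computed on generators only. -/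
lemma mul (A B : Matrix (Fin d) (Fin d) ℝ) :
    congrUpper (A * B) = congrUpper A * congrUpper B := by
  refine LinearMap.ext fun v => symmetricOfUpper_injective ?_
  simp [symmetricOfUpper_apply, Matrix.mul_assoc]

lemma one : congrUpper (1 : Matrix (Fin d) (Fin d) ℝ) = 1 := by
  refine LinearMap.ext fun v => symmetricOfUpper_injective ?_
  simp [symmetricOfUpper_apply]

lemma det_mul (A B : Matrix (Fin d) (Fin d) ℝ) :
    LinearMap.det (congrUpper (A * B)) =
      LinearMap.det (congrUpper A) * LinearMap.det (congrUpper B) := by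
  rw [mul, map_mul]

lemma det_ne_zero {A : Matrix (Fin d) (Fin d) ℝ} (hA : A.det ≠ 0) :
    LinearMap.det (congrUpper A) ≠ 0 := by
  intro h
  have := det_mul A A⁻¹
  rw [Matrix.mul_nonsing_inv _ (isUnit_iff_ne_zero.2 hA), one, h, zero_mul, map_one] at this
  exact one_ne_zero this

/-- In the product over the pairs `i ≤ j`, the factor `D i` occurs once for every pair `{i, j}` with
`j ≠ i` and twice for `(i, i)`, hence `d + 1` times. -/
lemma prod_upper (D : Fin d → ℝ) :
    ∏ p : {p : Fin d × Fin d // p.1 ≤ p.2}, D p.1.1 * D p.1.2 = (∏ i, D i) ^ (d + 1) := by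
  have h1 : ∏ p : {p : Fin d × Fin d // p.1 ≤ p.2}, D p.1.1 * D p.1.2
      = ∏ p : Fin d × Fin d, if p.1 ≤ p.2 then D p.1 * D p.2 else 1 := by
    rw [← Finset.prod_filter]
    exact (Finset.prod_subtype _ (by simp) (fun p : Fin d × Fin d => D p.1 * D p.2)).symm
  have h2 : ∀ i j : Fin d, (if i ≤ j then D i * D j else 1)
      = (if i ≤ j then D i else 1) * (if i ≤ j then D j else 1) := by
    intro i j; split_ifs <;> simp
  -- Once the indices of the second product are exchanged, both factors carry `D i`. The conditions
  -- `i ≤ j` and `j ≤ i` hold together only on the diagonal, which yields the extra factor.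
  have h3 : ∀ i j : Fin d, (if i ≤ j then D i else 1) * (if j ≤ i then D i else 1)
      = D i * (if i = j then D i else 1) := by
    intro i j
    rcases lt_trichotomy i j with h | rfl | h
    · simp [h.le, h.not_ge, h.ne]
    · simp
    · simp [h.le, h.not_ge, h.ne']
  rw [h1, Fintype.prod_prod_type]
  simp only [h2, Finset.prod_mul_distrib]
  rw [Finset.prod_comm (f := fun i j => if i ≤ j then D j else 1)]
  simp only [← Finset.prod_mul_distrib, h3]
  simp only [Finset.prod_mul_distrib, Finset.prod_const, Finset.card_univ, Fintype.card_fin,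
    Finset.prod_ite_eq, Finset.mem_univ, if_true, Finset.prod_pow, pow_succ]

/-- For diagonal `D` the action multiplies the coordinate `(i, j)` by `D i * D j`, so its matrix in
the standard basis is diagonal. -/
lemma det_diagonal (D : Fin d → ℝ) :
    LinearMap.det (congrUpper (diagonal D)) = (∏ i, D i) ^ (d + 1) := by
  rw [← LinearMap.det_toMatrix', ← prod_upper, ← Matrix.det_diagonal]
  congr 1
  ext p q
  rw [LinearMap.toMatrix'_apply]
  have : symmetricOfUpper (Pi.single q (1 : ℝ)) p.1.1 p.1.2 = if p = q then 1 else 0 := by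
    simp [symmetricOfUpper, p.2, Pi.single_apply]
  simp only [congrUpper, LinearMap.coe_mk, AddHom.coe_mk, diagonal_transpose, mul_diagonal,
    diagonal_mul, this, diagonal_apply]
  split_ifs <;> simp

/-- A transvection `T` is conjugate to its own square, so its Jacobian `x` satisfies `x = x²`; since
`x ≠ 0`, it is `1`. This avoids writing down the matrix of the action. -/
lemma det_transvection (t : TransvectionStruct (Fin d) ℝ) :
    LinearMap.det (congrUpper t.toMatrix) = 1 := by
  obtain ⟨i, j, hij, c⟩ := t
  simp only [TransvectionStruct.toMatrix_mk]
  have hT : LinearMap.det (congrUpper (transvection i j c)) ≠ 0 :=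
    det_ne_zero (by rw [det_transvection_of_ne _ _ hij]; exact one_ne_zero)
  -- Conjugation by the diagonal matrix with `2` in place `i` doubles the off-diagonal entry `c`,
  -- and doubling `c` amounts to squaring the transvection.
  set D : Matrix (Fin d) (Fin d) ℝ := diagonal (Function.update 1 i 2) with hD
  have hD0 : LinearMap.det (congrUpper D) ≠ 0 := det_ne_zero (by
    rw [hD, Matrix.det_diagonal, Finset.prod_ne_zero_iff]
    intro l _
    by_cases h : l = i <;> simp [h])
  have hconj : D * transvection i j c = transvection i j c * transvection i j c * D := by
    rw [transvection_mul_transvection_same _ _ hij]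
    ext a b
    simp only [hD, diagonal_mul, mul_diagonal, transvection, Matrix.add_apply, one_apply,
      single_apply, Function.update_apply]
    by_cases ha : a = i
    · subst ha
      by_cases hb : b = j
      · subst hb; simp [hij, hij.symm]; ring
      · by_cases hb' : a = b
        · subst hb'; simp [hij.symm]
        · simp [hb', Ne.symm hb]
    · by_cases hab : a = b
      · subst hab; simp [ha, Ne.symm ha]
      · simp [hab, Ne.symm ha]
  have h := congrArg (fun M => LinearMap.det (congrUpper M)) hconj
  simp only [det_mul] at h
  have := mul_right_cancel₀ hD0 ((mul_comm _ _).trans h)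
  exact (mul_left_cancel₀ hT (by rw [mul_one]; exact this)).symm

/-- The Jacobian determinant of `X ↦ A X Aᵀ` on the symmetric matrices. -/
theorem det_eq (A : Matrix (Fin d) (Fin d) ℝ) :
    LinearMap.det (congrUpper A) = A.det ^ (d + 1) := by
  induction A using diagonal_transvection_induction with
  | hdiag D _ => rw [det_diagonal, Matrix.det_diagonal]
  | htransvec t => rw [det_transvection, TransvectionStruct.det, one_pow]
  | hmul A B hA hB => rw [det_mul, hA, hB, Matrix.det_mul, mul_pow]

end congrUpper

/-! ### Pushforward of the Lebesgue measure on symmetric matrices. -/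

section Congruence

variable {d : ℕ}

lemma measurable_mul_mul (A B : Matrix (Fin d) (Fin d) ℝ) :
    Measurable fun X : Matrix (Fin d) (Fin d) ℝ => A * X * B := by
  refine measurable_pi_iff.2 fun i => measurable_pi_iff.2 fun j => ?_
  simp only [Matrix.mul_apply]
  refine Finset.measurable_sum _ fun l _ => Measurable.mul_const ?_ _
  refine Finset.measurable_sum _ fun m _ => Measurable.const_mul ?_ _
  exact (measurable_pi_apply l).comp (measurable_pi_apply m)

/-- The map `X ↦ C X C` for invertible `C`, as a measurable equivalence. -/
noncomputable def mulMulEquiv (C : Matrix (Fin d) (Fin d) ℝ) (hC : IsUnit C.det) :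
    Matrix (Fin d) (Fin d) ℝ ≃ᵐ Matrix (Fin d) (Fin d) ℝ where
  toFun X := C * X * C
  invFun X := C⁻¹ * X * C⁻¹
  left_inv X := by
    simp [Matrix.mul_assoc, Matrix.mul_nonsing_inv _ hC, Matrix.nonsing_inv_mul_cancel_left _ _ hC]
  right_inv X := by
    simp [Matrix.mul_assoc, Matrix.nonsing_inv_mul _ hC, Matrix.mul_nonsing_inv_cancel_left _ _ hC]
  measurable_toFun := measurable_mul_mul C C
  measurable_invFun := measurable_mul_mul C⁻¹ C⁻¹

lemma map_symmetricLebesgue {C : Matrix (Fin d) (Fin d) ℝ} (hC : C.PosDef) :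
    Measure.map (fun X => C * X * C) (symmetricLebesgue d) =
      ENNReal.ofReal ((C.det ^ (d + 1))⁻¹) • symmetricLebesgue d := by
  -- By symmetry of `C`, `X ↦ C X C` is the congruence `X ↦ C X Cᵀ`, to which `congrUpper` applies.
  have hT : C.transpose = C := by simpa using hC.isHermitian.eq
  have hdet : LinearMap.det (congrUpper C) = C.det ^ (d + 1) := congrUpper.det_eq C
  have hpos : 0 < C.det ^ (d + 1) := pow_pos hC.det_pos _
  have hcomp : (fun X => C * X * C) ∘ symmetricOfUpper = symmetricOfUpper ∘ congrUpper C := by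
    ext1 v
    simp [congrUpper.symmetricOfUpper_apply, hT]
  have hm : Measurable (congrUpper C) :=
    (LinearMap.continuous_of_finiteDimensional (congrUpper C)).measurable
  rw [symmetricLebesgue, Measure.map_map (measurable_mul_mul C C) (measurable_symmetricOfUpper d),
    hcomp, ← Measure.map_map (measurable_symmetricOfUpper d) hm,
    Real.map_linearMap_volume_pi_eq_smul_volume_pi (hdet ▸ hpos.ne'), Measure.map_smul, hdet,
    abs_of_pos (inv_pos.2 hpos)]

/-! ### Transformation of the density. -/

/-- For negative `y` the real power is `exp (a log |y|) cos (π a)`, and a positive factor changes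
only the exponential. Admitting every sign of `y` makes the density identity valid for all matrices
`X`, not just on the cone. -/
lemma mul_rpow_of_pos {x : ℝ} (hx : 0 < x) (y a : ℝ) : (x * y) ^ a = x ^ a * y ^ a := by
  rcases le_or_gt 0 y with hy | hy
  · exact Real.mul_rpow hx.le hy
  · rw [Real.rpow_def_of_neg (mul_neg_of_pos_of_neg hx hy), Real.rpow_def_of_neg hy,
      Real.rpow_def_of_pos hx, Real.log_mul hx.ne' hy.ne, add_mul, Real.exp_add, mul_assoc]

/-- The latent roots are read off from the characteristic polynomial, which is the same for `M N`
and `N M`. -/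
lemma latentRoots_conj {C : Matrix (Fin d) (Fin d) ℝ} (hC : IsUnit C.det)
    (A : Matrix (Fin d) (Fin d) ℝ) : latentRoots (C⁻¹ * A * C) = latentRoots A := by
  have : (C⁻¹ * A * C).charpoly = A.charpoly := by
    rw [Matrix.charpoly_mul_comm, Matrix.mul_nonsing_inv_cancel_left _ _ hC]
  funext i
  simp only [latentRoots, this]

lemma hypergeometric0F1_conj {C : Matrix (Fin d) (Fin d) ℝ} (hC : IsUnit C.det) (b : ℝ)
    (A : Matrix (Fin d) (Fin d) ℝ) :
    hypergeometric0F1 b (C⁻¹ * A * C) = hypergeometric0F1 b A := by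
  simp only [hypergeometric0F1, zonal, latentRoots_conj hC]

lemma etr_conj {C : Matrix (Fin d) (Fin d) ℝ} (hC : IsUnit C.det)
    (A : Matrix (Fin d) (Fin d) ℝ) : etr (C⁻¹ * A * C) = etr A := by
  rw [etr, Matrix.trace_mul_comm, Matrix.mul_nonsing_inv_cancel_left _ _ hC, etr]

/-- The exponents `ν / 2` in numerator and denominator cancel; the factor that survives is due to
the shift `-(d + 1) / 2` in the exponent of `|X|`. -/
lemma wishartDensity_congr {C : Matrix (Fin d) (Fin d) ℝ} (hC : 0 < C.det) (ν : ℝ)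
    (S Θ X : Matrix (Fin d) (Fin d) ℝ) :
    wishartDensity ν (C * S * C) (C⁻¹ * Θ * C) (C * X * C) =
      (C.det ^ (d + 1))⁻¹ * wishartDensity ν S Θ X := by
  have hu : IsUnit C.det := isUnit_iff_ne_zero.2 hC.ne'
  have hinv : (C * S * C)⁻¹ = C⁻¹ * S⁻¹ * C⁻¹ := by
    simp [Matrix.mul_inv_rev, Matrix.mul_assoc]
  have e1 : -(1 / 2 : ℝ) • ((C * S * C)⁻¹ * (C * X * C)) =
      C⁻¹ * (-(1 / 2 : ℝ) • (S⁻¹ * X)) * C := by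
    rw [hinv]
    simp [Matrix.mul_assoc, Matrix.nonsing_inv_mul_cancel_left _ _ hu]
  have e2 : -(1 / 2 : ℝ) • (C⁻¹ * Θ * C) = C⁻¹ * (-(1 / 2 : ℝ) • Θ) * C := by simp
  have e3 : (1 / 4 : ℝ) • (C⁻¹ * Θ * C * (C * S * C)⁻¹ * (C * X * C)) =
      C⁻¹ * ((1 / 4 : ℝ) • (Θ * S⁻¹ * X)) * C := by
    rw [hinv]
    simp [Matrix.mul_assoc, Matrix.nonsing_inv_mul_cancel_left _ _ hu,
      Matrix.mul_nonsing_inv_cancel_left _ _ hu]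
  have e4 : (C * X * C).det = C.det ^ 2 * X.det := by simp only [Matrix.det_mul]; ring
  have e5 : ((2 : ℝ) • (C * S * C)).det = C.det ^ 2 * ((2 : ℝ) • S).det := by
    simp only [Matrix.det_smul, Matrix.det_mul]; ring
  have hsq : (0 : ℝ) < C.det ^ 2 := by positivity
  -- The square of `|C|` doubles `(d + 1) / 2`, so a natural power of `|C|` splits off, the same as
  -- in the Jacobian.
  have e6 : (C.det ^ 2) ^ (ν / 2 - ((d : ℝ) + 1) / 2) =
      (C.det ^ 2) ^ (ν / 2) * (C.det ^ (d + 1))⁻¹ := by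
    rw [Real.rpow_sub hsq, div_eq_mul_inv]
    congr 2
    rw [← Real.rpow_natCast, ← Real.rpow_mul hC.le, ← Real.rpow_natCast]
    congr 1
    push_cast; ring
  have h0 : (C.det ^ 2) ^ (ν / 2) ≠ 0 := (Real.rpow_pos_of_pos hsq _).ne'
  rw [wishartDensity, e1, e2, e3, e4, e5, etr_conj hu, etr_conj hu, hypergeometric0F1_conj hu,
    mul_rpow_of_pos hsq, mul_rpow_of_pos hsq, e6, wishartDensity, mul_assoc (_ ^ (ν / 2)),
    mul_assoc (_ ^ (ν / 2)), mul_assoc (_ ^ (ν / 2)), mul_div_mul_left _ _ h0]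
  ring

/-! ### Change of variables for the distribution. -/

/-- Conjugation by a positive definite matrix maps `W_d(ν, S, Θ)` to `W_d(ν, C S C, C⁻¹ Θ C)`. -/
theorem map_noncentralWishart {C : Matrix (Fin d) (Fin d) ℝ} (hC : C.PosDef) (ν : ℝ)
    (S Θ : Matrix (Fin d) (Fin d) ℝ) :
    Measure.map (fun X => C * X * C) (noncentralWishart ν S Θ) =
      noncentralWishart ν (C * S * C) (C⁻¹ * Θ * C) := by
  have hu : IsUnit C.det := isUnit_iff_ne_zero.2 hC.det_pos.ne'
  have hpos : 0 < (C.det ^ (d + 1))⁻¹ := inv_pos.2 (pow_pos hC.det_pos _)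
  set c : ENNReal := ENNReal.ofReal ((C.det ^ (d + 1))⁻¹) with hc
  have hc0 : c ≠ 0 := (ENNReal.ofReal_pos.2 hpos).ne'
  have hct : c ≠ ⊤ := ENNReal.ofReal_ne_top
  let e := mulMulEquiv C hu
  have he : Measure.map e (symmetricLebesgue d) = c • symmetricLebesgue d :=
    map_symmetricLebesgue hC
  have hpre : e ⁻¹' {X | X.PosDef} = {X | X.PosDef} := by
    ext X
    have := Matrix.IsUnit.posDef_star_right_conjugate_iff
      ((Matrix.isUnit_iff_isUnit_det C).2 hu) (x := X)
    rw [Matrix.star_eq_conjTranspose, hC.isHermitian.eq] at this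
    exact this
  have hres : Measure.map e ((symmetricLebesgue d).restrict {X | X.PosDef}) =
      c • (symmetricLebesgue d).restrict {X | X.PosDef} := by
    rw [← Measure.restrict_smul, ← he, e.restrict_map, hpre]
  have hdens : ∀ X, ENNReal.ofReal (wishartDensity ν (C * S * C) (C⁻¹ * Θ * C) (e X)) =
      c * ENNReal.ofReal (wishartDensity ν S Θ X) := fun X => by
    rw [← ENNReal.ofReal_mul hpos.le, ← wishartDensity_congr hC.det_pos]
    rfl
  -- Scaled by `c`, both sides give a measurable set `s` the integral over `e ⁻¹' s` of one
  -- function: on the left `c` multiplies the old density, on the right it is absorbed by the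
  -- pushforward of the base measure. As `e` is a measurable equivalence and `c` is finite, no
  -- measurability of the density, hence of `₀F₁`, has to be shown.
  have key : c • Measure.map e (noncentralWishart ν S Θ) =
      c • noncentralWishart ν (C * S * C) (C⁻¹ * Θ * C) := by
    rw [noncentralWishart, noncentralWishart, ← Measure.map_smul, ← withDensity_smul' c _ hct,
      ← withDensity_smul_measure, ← hres]
    ext s hs
    rw [e.map_apply, withDensity_apply _ (e.measurable hs), withDensity_apply _ hs,
      e.restrict_map, lintegral_map_equiv]
    exact lintegral_congr fun X => (hdens X).symm
  -- The constant can be cancelled because it is neither `0` nor `⊤`.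
  have := congrArg (fun μ => c⁻¹ • μ) key
  simp only [smul_smul, ENNReal.inv_mul_cancel hc0 hct, one_smul] at this
  exact this

end Congruence

/-! ### Admissibility of the new parameters, and the law of `C X C`. -/

theorem lemma1 {d : ℕ} (hd : 1 ≤ d) {ν : ℝ} (hν : (d : ℝ) - 1 < ν)
    {C S Θ : Matrix (Fin d) (Fin d) ℝ} (hC : C.PosDef) (hS : S.PosDef)
    (hΘ : (Θ * S⁻¹).PosSemidef)
    {Ω : Type*} [MeasurableSpace Ω] {P : Measure Ω} [IsProbabilityMeasure P]
    {X : Ω → Matrix (Fin d) (Fin d) ℝ} (hX : HasLaw X (noncentralWishart ν S Θ) P) :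
    (C * S * C).PosDef ∧ ((C⁻¹ * Θ * C) * (C * S * C)⁻¹).PosSemidef ∧
      HasLaw (fun ω => C * X ω * C) (noncentralWishart ν (C * S * C) (C⁻¹ * Θ * C)) P := by
  have hu : IsUnit C.det := isUnit_iff_ne_zero.2 hC.det_pos.ne'
  refine ⟨?_, ?_, ?_⟩
  · have := (Matrix.IsUnit.posDef_star_right_conjugate_iff
      ((Matrix.isUnit_iff_isUnit_det C).2 hu)).2 hS
    rwa [Matrix.star_eq_conjTranspose, hC.isHermitian.eq] at this
  -- Here `C⁻¹ Θ C (C S C)⁻¹ = C⁻¹ (Θ S⁻¹) C⁻¹`, a congruence of `Θ S⁻¹` by the symmetric matrix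
  -- `C⁻¹`.
  · have h := hΘ.mul_mul_conjTranspose_same C⁻¹
    rw [hC.isHermitian.inv.eq] at h
    convert h using 1
    simp [Matrix.mul_inv_rev, Matrix.mul_assoc, Matrix.mul_nonsing_inv_cancel_left _ _ hu]
  · exact HasLaw.comp ⟨(measurable_mul_mul C C).aemeasurable, map_noncentralWishart hC ν S Θ⟩ hX
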